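/- **Setting.** Let $\mathcal U,\mathcal X,\mathcal Y$ be Hausdorff spaces and $\mathbb Z_-=\{t\in\mathbb Z: t\le 0\}$. Let $T$ denote the right shift $(a_t)_t\mapsto(a_{t-1})_t$ and $\sigma$ the left shift. Let $\mathbf U^-\subseteq\mathcal U^{\mathbb Z_-}$, $\mathbf X^-\subseteq\mathcal X^{\mathbb Z_-}$, $\mathbf Y^-\subseteq\mathcal Y^{\mathbb Z_-}$ satisfy $T^{-1}(\mathbf U^-)=\mathbf U^-$ and likewise for $\mathbf X^-,\mathbf Y^-$, and let $\mathbf U\subseteq\mathcal U^{\mathbb Z}$ satisfy $\sigma(\mathbf U)=\mathbf U$ and $\tau(\mathbf U)=\mathbf U^-$, where $\tau$ is the truncation $(u_t)_{t\in\mathbb Z}\mapsto(u_t)_{t\le 0}$. These four sets carry topologies at least as fine as the product topologies such that: $T$ is continuous on $\mathbf U^-,\mathbf X^-,\mathbf Y^-$ and $\sigma$ is a homeomorphism of $\mathbf U$; $\tau:\mathbf U\to\mathbf U^-$ is continuous with a continuous right-inverse; the concatenation maps $\mathbf X^-\times\mathcal X\to\mathbf X^-$ and $\mathbf U^-\times\mathcal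 U\to\mathbf U^-$, $(a,c)\mapsto(\dots,a_{-1},a_0,c)$, are continuous; for all $u,u'\in\mathbf U^-$, $(\dots,u'_{-1},u'_0,u_{-n},\dots,u_0)\to u$ as $n\to\infty$; $\mathbf Y^-$ is completely regular; $\mathbf U$ and $\mathbf U^-$ carry the product topologies; and $\mathbf U,\mathbf U^-,\mathbf X^-$ are Polish. Let $f:\mathcal X\times\mathcal U\to\mathcal X$ be continuous and let $h:\mathcal X\to\mathcal Y$ be such that $x\mapsto(h(x_t))_t$ is a well-defined continuous map $\mathbf X^-\to\mathbf Y^-$. Put $H(x,u)=((h(x_t))_t,u)$ on $\mathbf X^-\times\mathbf U^-$ and $\varphi(x,u)=((\dots,x_{-1},x_0,f(x_0,u_1)),\sigma(u))$ on $\mathbf X^-\times\mathbf U$; let $T$ and $\tau$ act on pairs by $T(x,u)=(Tx,Tu)$ and $\tau(x,u)=(x,\tau(u))$; let $\pi_A$ denote projections. Let $P(Z)$ be the set of Radon probability measures on $Z$. Let $\mathcal P^-_{\rm state}\subseteq P(\mathbf X^-\times\mathbf U^-)$ and $\mathcal P^-_{\rm in}\subseteq P(\mathbf U^-)$ satisfy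 $(T_*)^{-1}(\mathcal P^-_{\rm state})=\mathcal P^-_{\rm state}$, $(T_*)^{-1}(\mathcal P^-_{\rm in})=\mathcal P^-_{\rm in}$ and $(\pi_{\mathbf U^-})_*(\mathcal P^-_{\rm state})=\mathcal P^-_{\rm in}$. Put $\mathcal P^-_{\rm out}=(\pi_{\mathbf U^-})_*^{-1}(\mathcal P^-_{\rm in})\subseteq P(\mathbf Y^-\times\mathbf U^-)$, $\mathcal P_{\rm state}=(\tau_*)^{-1}(\mathcal P^-_{\rm state})\subseteq P(\mathbf X^-\times\mathbf U)$, $\mathcal P_{\rm in}=(\tau_*)^{-1}(\mathcal P^-_{\rm in})\subseteq P(\mathbf U)$. These five sets carry topologies at least as fine as the weak topologies for which $(\pi_{\mathbf U^-})_*:\mathcal P^-_{\rm state}\to\mathcal P^-_{\rm in}$, $(\pi_{\mathbf U})_*:\mathcal P_{\rm state}\to\mathcal P_{\rm in}$, $T_*,\varphi_*:\mathcal P_{\rm state}\to\mathcal P_{\rm state}$, $\sigma_*:\mathcal P_{\rm in}\to\mathcal P_{\rm in}$ and $H_*:\mathcal P^-_{\rm state}\to\mathcal P^-_{\rm out}$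 are continuous. **Definitions.** A *stochastic solution* is a $\mu\in\mathcal P^-_{\rm state}$ that is the law of some $(X,U)$ with $X_t=f(X_{t-1},U_t)$ almost surely for every $t\le 0$. A measure $\mu\in P(\mathbf X^-\times\mathbf U^-)$ is *causal* if for every $t\le 0$ the sigma-algebras generated by $T^{-t}\circ\pi_{\mathbf X^-}$ and by $\pi_{\mathbf U^-}$ are conditionally independent under $\mu$ given the sigma-algebra generated by $T^{-t}\circ\pi_{\mathbf U^-}$. *(Causal) stochastic outputs* are the measures $H_*\mu$ with $\mu$ a (causal) stochastic solution. A solution or output is *for the input law* $\Xi\in\mathcal P^-_{\rm in}$ if its $\mathbf U^-$-marginal is $\Xi$. The *(causal) stochastic ESP* holds if every $\Xi\in\mathcal P^-_{\rm in}$ has exactly one (causal) stochastic solution; the *(causal) stochastic ESP in the outputs* holds if every $\Xi\in\mathcal P^-_{\rm in}$ has exactly one (causal) stochastic output. **Proposition.** Suppose that for every $\Xi\in\mathcal P^-_{\rm in}$ the fiber $\{\mu\in\mathcal P^-_{\rm state}:(\pi_{\mathbf U^-})_*\mu=\Xi\}$ is compact in $\mathcal P^-_{\rm state}$. Then for every $\Xi\in\mathcal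 P^-_{\rm in}$ there is a causal stochastic solution for $\Xi$. In particular, if the system has the stochastic ESP, then it has the causal stochastic ESP; and if it has the stochastic ESP in the outputs, then it has the causal stochastic ESP in the outputs. -/

import Mathlib

open MeasureTheory ProbabilityTheory Filter Topology Set

namespace StochReservoir

noncomputable section

/-! ### Sequence spaces

Left-infinite sequences `(a_t)_{t ≤ 0}` are encoded as functions `a : ℕ → A`, where `a n` is the
entry at time `t = -n`.  Bi-infinite sequences are functions `ℤ → A`. -/

/-- The right shift `(a_t)_t ↦ (a_{t-1})_t` on left-infinite sequences. -/
def shiftSeq {A : Type*} (a : ℕ → A) : ℕ → A := fun n => a (n + 1)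

/-- The concatenation `((a_t)_{t ≤ 0}, c) ↦ (…, a_{-1}, a_0, c)`. -/
def concatSeq {A : Type*} (a : ℕ → A) (c : A) : ℕ → A
  | 0 => c
  | n + 1 => a n

/-- The left shift `(u_t)_t ↦ (u_{t+1})_t` on bi-infinite sequences. -/
def leftShiftSeq {A : Type*} (u : ℤ → A) : ℤ → A := fun t => u (t + 1)

/-- The right shift `(u_t)_t ↦ (u_{t-1})_t` on bi-infinite sequences. -/
def rightShiftSeq {A : Type*} (u : ℤ → A) : ℤ → A := fun t => u (t - 1)

/-- The truncation `(u_t)_{t ∈ ℤ} ↦ (u_t)_{t ≤ 0}`. -/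
def truncSeq {A : Type*} (u : ℤ → A) : ℕ → A := fun n => u (-(n : ℤ))

/-- A backwards shift-invariant set of left-infinite sequences, `T⁻¹(S) = S`, with a topology at
least as fine as the product topology. -/
structure PastSpace (A : Type*) [TopologicalSpace A] where
  carrier : Set (ℕ → A)
  shift_mem_iff : ∀ a : ℕ → A, shiftSeq a ∈ carrier ↔ a ∈ carrier
  top : TopologicalSpace carrier
  top_le : top ≤ instTopologicalSpaceSubtype

/-- The points of a `PastSpace`, as a type that carries the chosen topology (and not automatically
the product topology) and its Borel sigma-algebra. -/
def PastSpace.Seq {A : Type*} [TopologicalSpace A] (S : PastSpace A) : Type _ := S.carrier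

/-- A shift-invariant set of bi-infinite sequences, `σ(S) = S`, with a topology at least as fine as
the product topology. -/
structure FullSpace (A : Type*) [TopologicalSpace A] where
  carrier : Set (ℤ → A)
  leftShift_mem_iff : ∀ u : ℤ → A, leftShiftSeq u ∈ carrier ↔ u ∈ carrier
  top : TopologicalSpace carrier
  top_le : top ≤ instTopologicalSpaceSubtype

/-- The points of a `FullSpace`, as a type that carries the chosen topology and its Borel
sigma-algebra. -/
def FullSpace.Seq {A : Type*} [TopologicalSpace A] (S : FullSpace A) : Type _ := S.carrier

section SequenceSpaces

variable {A : Type*} [TopologicalSpace A]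

instance (S : PastSpace A) : TopologicalSpace S.Seq := S.top

instance (S : PastSpace A) : MeasurableSpace S.Seq := borel S.Seq

instance (S : PastSpace A) : BorelSpace S.Seq := ⟨rfl⟩

instance (S : FullSpace A) : TopologicalSpace S.Seq := S.top

instance (S : FullSpace A) : MeasurableSpace S.Seq := borel S.Seq

instance (S : FullSpace A) : BorelSpace S.Seq := ⟨rfl⟩

/-- The point of a `PastSpace` given by a sequence in its carrier. -/
def PastSpace.ofMem (S : PastSpace A) (a : ℕ → A) (ha : a ∈ S.carrier) : S.Seq := ⟨a, ha⟩

/-- The underlying sequence of a point of a `PastSpace`. -/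
def PastSpace.val (S : PastSpace A) (a : S.Seq) : ℕ → A := Subtype.val a

/-- The underlying sequence of a point of a `FullSpace`. -/
def FullSpace.val (S : FullSpace A) (u : S.Seq) : ℤ → A := Subtype.val u

theorem PastSpace.continuous_val (S : PastSpace A) : Continuous S.val :=
  continuous_le_dom S.top_le continuous_subtype_val

theorem FullSpace.continuous_val (S : FullSpace A) : Continuous S.val :=
  continuous_le_dom S.top_le continuous_subtype_val

/-- The right-shift operator `T` on a space of left-infinite sequences. -/
def PastSpace.shift (S : PastSpace A) (a : S.Seq) : S.Seq :=
  S.ofMem (shiftSeq (S.val a)) ((S.shift_mem_iff _).2 a.2)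

/-- The concatenation map on a space of left-infinite sequences. -/
def PastSpace.concat (S : PastSpace A) (p : S.Seq × A) : S.Seq :=
  S.ofMem (concatSeq (S.val p.1) p.2) ((S.shift_mem_iff _).1 p.1.2)

/-- The left-shift operator `σ` on a space of bi-infinite sequences. -/
def FullSpace.leftShift (S : FullSpace A) (u : S.Seq) : S.Seq :=
  ⟨leftShiftSeq (S.val u), (S.leftShift_mem_iff _).2 u.2⟩

/-- The right-shift operator `T` on a space of bi-infinite sequences. -/
def FullSpace.rightShift (S : FullSpace A) (u : S.Seq) : S.Seq :=
  ⟨rightShiftSeq (S.val u), (S.leftShift_mem_iff _).1 (by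
    have h : leftShiftSeq (rightShiftSeq (S.val u)) = S.val u := by
      funext t
      simp [leftShiftSeq, rightShiftSeq]
    rw [h]
    exact u.2)⟩

end SequenceSpaces

/-! ### State-space systems -/

/-- A state-space system with state map `f` and readout `h`, together with its sequence spaces of
past inputs, past states, past outputs and bi-infinite inputs, under the standing assumptions:
compatibility of the topologies with shifts, truncation and concatenation, convergence of
concatenated inputs, complete regularity, product topologies on the two input sequence spaces,
and Polish input and state sequence spaces. -/
structure StateSpaceSystem (U X Y : Type*) [TopologicalSpace U] [TopologicalSpace X]
    [TopologicalSpace Y] where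
  /-- past input sequences -/
  uPast : PastSpace U
  /-- past state sequences -/
  xPast : PastSpace X
  /-- past output sequences -/
  yPast : PastSpace Y
  /-- bi-infinite input sequences -/
  uFull : FullSpace U
  continuous_shift_uPast : Continuous uPast.shift
  continuous_shift_xPast : Continuous xPast.shift
  continuous_shift_yPast : Continuous yPast.shift
  continuous_leftShift : Continuous uFull.leftShift
  continuous_rightShift : Continuous uFull.rightShift
  /-- truncation maps `uFull` onto `uPast` -/
  trunc_image : truncSeq '' uFull.carrier = uPast.carrier
  continuous_trunc : Continuous fun u : uFull.Seq =>
    uPast.ofMem (truncSeq (uFull.val u)) (trunc_image ▸ Set.mem_image_of_mem _ u.2)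
  exists_trunc_rightInverse : ∃ j : uPast.Seq → uFull.Seq, Continuous j ∧
    ∀ u : uPast.Seq, truncSeq (uFull.val (j u)) = uPast.val u
  continuous_concat_xPast : Continuous xPast.concat
  continuous_concat_uPast : Continuous uPast.concat
  /-- `(…, u'_{-1}, u'_0, u_{-n}, …, u_0) → u` as `n → ∞` -/
  tendsto_concat : ∀ (u u' : uPast.Seq) (v : ℕ → uPast.Seq),
    (∀ n k : ℕ, uPast.val (v n) k =
      if k ≤ n then uPast.val u k else uPast.val u' (k - (n + 1))) →
    Tendsto v atTop (𝓝 u)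
  /-- the state map -/
  f : X × U → X
  continuous_f : Continuous f
  /-- the readout -/
  h : X → Y
  h_mem : ∀ x ∈ xPast.carrier, (fun n => h (x n)) ∈ yPast.carrier
  continuous_readout : Continuous fun x : xPast.Seq =>
    yPast.ofMem (fun n => h (xPast.val x n)) (h_mem _ x.2)
  /-- `uPast`, `xPast` and `uFull` are completely regular because they are Polish. -/
  completelyRegular_yPast : CompletelyRegularSpace yPast.Seq
  /-- `uPast` carries the product topology -/
  isInducing_uPast : IsInducing uPast.val
  /-- `uFull` carries the product topology -/
  isInducing_uFull : IsInducing uFull.val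
  polish_uPast : PolishSpace uPast.Seq
  polish_xPast : PolishSpace xPast.Seq
  polish_uFull : PolishSpace uFull.Seq

/-- The set `P(Z)` of Radon probability measures on a space `Z` (Borel probability measures that are
inner regular with respect to compact sets), with the weak topology. -/
abbrev RadonProb (Z : Type*) [TopologicalSpace Z] [MeasurableSpace Z] : Type _ :=
  {μ : ProbabilityMeasure Z // (μ : Measure Z).InnerRegular}

/-- The push-forward of a Radon probability measure under a continuous map. -/
def RadonProb.map {Z W : Type*} [TopologicalSpace Z] [MeasurableSpace Z] [BorelSpace Z]
    [TopologicalSpace W] [MeasurableSpace W] [BorelSpace W] (g : Z → W) (hg : Continuous g)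
    (μ : RadonProb Z) : RadonProb W :=
  ⟨μ.1.map hg.measurable.aemeasurable, by
    have := μ.2
    exact Measure.InnerRegular.map_of_continuous hg⟩

theorem RadonProb.map_map {Z W V : Type*} [TopologicalSpace Z] [MeasurableSpace Z] [BorelSpace Z]
    [TopologicalSpace W] [MeasurableSpace W] [BorelSpace W]
    [TopologicalSpace V] [MeasurableSpace V] [BorelSpace V]
    {g : Z → W} (hg : Continuous g) {k : W → V} (hk : Continuous k) (μ : RadonProb Z) :
    RadonProb.map k hk (RadonProb.map g hg μ) = RadonProb.map (k ∘ g) (hk.comp hg) μ := by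
  apply Subtype.ext
  apply Subtype.ext
  exact Measure.map_map hk.measurable hg.measurable

theorem RadonProb.map_congr {Z W : Type*} [TopologicalSpace Z] [MeasurableSpace Z] [BorelSpace Z]
    [TopologicalSpace W] [MeasurableSpace W] [BorelSpace W] {g k : Z → W} (hg : Continuous g)
    (hk : Continuous k) (h : g = k) (μ : RadonProb Z) :
    RadonProb.map g hg μ = RadonProb.map k hk μ := by
  subst h
  rfl

theorem RadonProb.map_id {Z : Type*} [TopologicalSpace Z] [MeasurableSpace Z] [BorelSpace Z]
    {g : Z → Z} (hg : Continuous g) (h : g = id) (μ : RadonProb Z) : RadonProb.map g hg μ = μ := by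
  subst h
  apply Subtype.ext
  apply Subtype.ext
  exact Measure.map_id

namespace StateSpaceSystem

variable {U X Y : Type*} [TopologicalSpace U] [TopologicalSpace X] [TopologicalSpace Y]
  (S : StateSpaceSystem U X Y)

/-- Past input sequences. -/
abbrev UPast : Type _ := S.uPast.Seq

/-- Past state sequences. -/
abbrev XPast : Type _ := S.xPast.Seq

/-- Past output sequences. -/
abbrev YPast : Type _ := S.yPast.Seq

/-- Bi-infinite input sequences. -/
abbrev UFull : Type _ := S.uFull.Seq

instance : PolishSpace S.uPast.Seq := S.polish_uPast

instance : PolishSpace S.xPast.Seq := S.polish_xPast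

instance : PolishSpace S.uFull.Seq := S.polish_uFull

/-- The right shift `T` on past state-input pairs. -/
def shiftPast (p : S.XPast × S.UPast) : S.XPast × S.UPast := (S.xPast.shift p.1, S.uPast.shift p.2)

/-- The right shift `T` on pairs of a past state sequence and a bi-infinite input sequence. -/
def shiftFull (p : S.XPast × S.UFull) : S.XPast × S.UFull :=
  (S.xPast.shift p.1, S.uFull.rightShift p.2)

/-- The truncation `τ` of bi-infinite input sequences. -/
def truncIn (u : S.UFull) : S.UPast :=
  S.uPast.ofMem (truncSeq (S.uFull.val u)) (S.trunc_image ▸ Set.mem_image_of_mem _ u.2)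

/-- The truncation `τ` on pairs of a past state sequence and a bi-infinite input sequence. -/
def trunc (p : S.XPast × S.UFull) : S.XPast × S.UPast := (p.1, S.truncIn p.2)

/-- The dynamical system `φ(x, u) = ((x, f(x_0, u_1)), σ(u))`. -/
def phi (p : S.XPast × S.UFull) : S.XPast × S.UFull :=
  (S.xPast.concat (p.1, S.f (S.xPast.val p.1 0, S.uFull.val p.2 1)), S.uFull.leftShift p.2)

/-- The extended readout `H(x, u) = ((h(x_t))_t, u)`. -/
def readout (p : S.XPast × S.UPast) : S.YPast × S.UPast :=
  (S.yPast.ofMem (fun n => S.h (S.xPast.val p.1 n)) (S.h_mem _ p.1.2), p.2)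

theorem continuous_shiftPast : Continuous S.shiftPast :=
  S.continuous_shift_xPast.prodMap S.continuous_shift_uPast

theorem continuous_shiftFull : Continuous S.shiftFull :=
  S.continuous_shift_xPast.prodMap S.continuous_rightShift

theorem continuous_truncIn : Continuous S.truncIn := S.continuous_trunc

theorem continuous_truncPair : Continuous S.trunc :=
  continuous_id.prodMap S.continuous_truncIn

theorem continuous_phi : Continuous S.phi := by
  have h1 : Continuous fun p : S.XPast × S.UFull => S.xPast.val p.1 0 :=
    (continuous_apply 0).comp (S.xPast.continuous_val.comp continuous_fst)
  have h2 : Continuous fun p : S.XPast × S.UFull => S.uFull.val p.2 1 :=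
    (continuous_apply 1).comp (S.uFull.continuous_val.comp continuous_snd)
  exact (S.continuous_concat_xPast.comp
    (continuous_fst.prodMk (S.continuous_f.comp (h1.prodMk h2)))).prodMk
    (S.continuous_leftShift.comp continuous_snd)

theorem continuous_extendedReadout : Continuous S.readout :=
  S.continuous_readout.prodMap continuous_id

/-! Push-forwards on Radon probability laws. -/

/-- `T_*` on laws of past state-input pairs. -/
def shiftLaw : RadonProb (S.XPast × S.UPast) → RadonProb (S.XPast × S.UPast) :=
  RadonProb.map S.shiftPast S.continuous_shiftPast

/-- `T_*` on laws of past inputs. -/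
def shiftInLaw : RadonProb S.UPast → RadonProb S.UPast :=
  RadonProb.map S.uPast.shift S.continuous_shift_uPast

/-- `T_*` on laws on pairs of a past state sequence and a bi-infinite input sequence. -/
def shiftFullLaw : RadonProb (S.XPast × S.UFull) → RadonProb (S.XPast × S.UFull) :=
  RadonProb.map S.shiftFull S.continuous_shiftFull

/-- `σ_*` on laws of bi-infinite inputs. -/
def leftShiftLaw : RadonProb S.UFull → RadonProb S.UFull :=
  RadonProb.map S.uFull.leftShift S.continuous_leftShift

/-- `φ_*`. -/
def phiLaw : RadonProb (S.XPast × S.UFull) → RadonProb (S.XPast × S.UFull) :=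
  RadonProb.map S.phi S.continuous_phi

/-- `τ_*` on laws on pairs of a past state sequence and a bi-infinite input sequence. -/
def truncLaw : RadonProb (S.XPast × S.UFull) → RadonProb (S.XPast × S.UPast) :=
  RadonProb.map S.trunc S.continuous_truncPair

/-- `τ_*` on laws of bi-infinite inputs. -/
def truncInLaw : RadonProb S.UFull → RadonProb S.UPast :=
  RadonProb.map S.truncIn S.continuous_truncIn

/-- The push-forward under the projection of past state-input pairs to past inputs. -/
def inMarginal : RadonProb (S.XPast × S.UPast) → RadonProb S.UPast :=
  RadonProb.map Prod.snd continuous_snd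

/-- The push-forward under the projection of past output-input pairs to past inputs. -/
def outInMarginal : RadonProb (S.YPast × S.UPast) → RadonProb S.UPast :=
  RadonProb.map Prod.snd continuous_snd

/-- The push-forward under the projection to bi-infinite inputs. -/
def fullInMarginal : RadonProb (S.XPast × S.UFull) → RadonProb S.UFull :=
  RadonProb.map Prod.snd continuous_snd

/-- `H_*`. -/
def readoutLaw : RadonProb (S.XPast × S.UPast) → RadonProb (S.YPast × S.UPast) :=
  RadonProb.map S.readout S.continuous_extendedReadout

end StateSpaceSystem

/-! ### Admissible laws -/

/-- The sets of admissible state laws and input laws: backwards shift-invariant sets of Radon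
probability measures such that the input laws are the input marginals of the state laws. -/
structure LawSets {U X Y : Type*} [TopologicalSpace U] [TopologicalSpace X] [TopologicalSpace Y]
    (S : StateSpaceSystem U X Y) where
  statePast : Set (RadonProb (S.XPast × S.UPast))
  inPast : Set (RadonProb S.UPast)
  shift_preimage_statePast : S.shiftLaw ⁻¹' statePast = statePast
  shift_preimage_inPast : S.shiftInLaw ⁻¹' inPast = inPast
  inMarginal_image : S.inMarginal '' statePast = inPast

namespace LawSets

variable {U X Y : Type*} [TopologicalSpace U] [TopologicalSpace X] [TopologicalSpace Y]
  {S : StateSpaceSystem U X Y} (L : LawSets S)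

/-- The admissible output laws. -/
def outPast : Set (RadonProb (S.YPast × S.UPast)) := S.outInMarginal ⁻¹' L.inPast

/-- The domain of the stochastic dynamical system `φ_*`. -/
def stateFull : Set (RadonProb (S.XPast × S.UFull)) := S.truncLaw ⁻¹' L.statePast

/-- The laws of bi-infinite inputs with admissible truncation. -/
def inFull : Set (RadonProb S.UFull) := S.truncInLaw ⁻¹' L.inPast

theorem mapsTo_inMarginal : MapsTo S.inMarginal L.statePast L.inPast := fun _ hμ =>
  L.inMarginal_image ▸ Set.mem_image_of_mem _ hμ

theorem mapsTo_fullInMarginal : MapsTo S.fullInMarginal L.stateFull L.inFull := by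
  intro μ hμ
  have h := L.mapsTo_inMarginal hμ
  have e : S.truncInLaw (S.fullInMarginal μ) = S.inMarginal (S.truncLaw μ) := by
    unfold StateSpaceSystem.truncInLaw StateSpaceSystem.fullInMarginal StateSpaceSystem.inMarginal
      StateSpaceSystem.truncLaw
    rw [RadonProb.map_map, RadonProb.map_map]
    rfl
  change S.truncInLaw (S.fullInMarginal μ) ∈ L.inPast
  rw [e]
  exact h

theorem mapsTo_shiftFullLaw : MapsTo S.shiftFullLaw L.stateFull L.stateFull := by
  intro μ hμ
  have e : S.truncLaw (S.shiftFullLaw μ) = S.shiftLaw (S.truncLaw μ) := by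
    unfold StateSpaceSystem.shiftFullLaw StateSpaceSystem.shiftLaw StateSpaceSystem.truncLaw
    rw [RadonProb.map_map, RadonProb.map_map]
    apply RadonProb.map_congr
    funext p
    refine Prod.ext rfl (Subtype.ext ?_)
    funext n
    change S.uFull.val p.2 (-(n : ℤ) - 1) = S.uFull.val p.2 (-((n + 1 : ℕ) : ℤ))
    congr 1
    push_cast
    ring
  change S.truncLaw (S.shiftFullLaw μ) ∈ L.statePast
  rw [e]
  have h : S.truncLaw μ ∈ S.shiftLaw ⁻¹' L.statePast := by
    rw [L.shift_preimage_statePast]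
    exact hμ
  exact h

theorem mapsTo_phiLaw : MapsTo S.phiLaw L.stateFull L.stateFull := by
  intro μ hμ
  have e : S.shiftLaw (S.truncLaw (S.phiLaw μ)) = S.truncLaw μ := by
    unfold StateSpaceSystem.phiLaw StateSpaceSystem.shiftLaw StateSpaceSystem.truncLaw
    rw [RadonProb.map_map, RadonProb.map_map]
    apply RadonProb.map_congr
    funext p
    refine Prod.ext rfl (Subtype.ext ?_)
    funext n
    change S.uFull.val p.2 (-((n + 1 : ℕ) : ℤ) + 1) = S.uFull.val p.2 (-(n : ℤ))
    congr 1
    push_cast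
    ring
  change S.truncLaw (S.phiLaw μ) ∈ L.statePast
  rw [← L.shift_preimage_statePast]
  change S.shiftLaw (S.truncLaw (S.phiLaw μ)) ∈ L.statePast
  rw [e]
  exact hμ

theorem mapsTo_leftShiftLaw : MapsTo S.leftShiftLaw L.inFull L.inFull := by
  intro μ hμ
  have e : S.shiftInLaw (S.truncInLaw (S.leftShiftLaw μ)) = S.truncInLaw μ := by
    unfold StateSpaceSystem.leftShiftLaw StateSpaceSystem.shiftInLaw StateSpaceSystem.truncInLaw
    rw [RadonProb.map_map, RadonProb.map_map]
    apply RadonProb.map_congr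
    funext u
    refine Subtype.ext ?_
    funext n
    change S.uFull.val u (-((n + 1 : ℕ) : ℤ) + 1) = S.uFull.val u (-(n : ℤ))
    congr 1
    push_cast
    ring
  change S.truncInLaw (S.leftShiftLaw μ) ∈ L.inPast
  rw [← L.shift_preimage_inPast]
  change S.shiftInLaw (S.truncInLaw (S.leftShiftLaw μ)) ∈ L.inPast
  rw [e]
  exact hμ

theorem mapsTo_readoutLaw : MapsTo S.readoutLaw L.statePast L.outPast := by
  intro μ hμ
  have e : S.outInMarginal (S.readoutLaw μ) = S.inMarginal μ := by
    unfold StateSpaceSystem.outInMarginal StateSpaceSystem.readoutLaw StateSpaceSystem.inMarginal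
    rw [RadonProb.map_map]
    rfl
  change S.outInMarginal (S.readoutLaw μ) ∈ L.inPast
  rw [e]
  exact L.mapsTo_inMarginal hμ

/-- Admissible topologies on the sets of laws: each at least as fine as the weak topology, and such
that the relevant push-forward maps are continuous. -/
structure Topologies where
  topStatePast : TopologicalSpace L.statePast
  topInPast : TopologicalSpace L.inPast
  topStateFull : TopologicalSpace L.stateFull
  topInFull : TopologicalSpace L.inFull
  topOutPast : TopologicalSpace L.outPast
  statePast_le_weak : topStatePast ≤ instTopologicalSpaceSubtype
  inPast_le_weak : topInPast ≤ instTopologicalSpaceSubtype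
  stateFull_le_weak : topStateFull ≤ instTopologicalSpaceSubtype
  inFull_le_weak : topInFull ≤ instTopologicalSpaceSubtype
  outPast_le_weak : topOutPast ≤ instTopologicalSpaceSubtype
  continuous_inMarginal : Continuous[topStatePast, topInPast] L.mapsTo_inMarginal.restrict
  continuous_fullInMarginal :
    Continuous[topStateFull, topInFull] L.mapsTo_fullInMarginal.restrict
  continuous_shiftFullLaw :
    Continuous[topStateFull, topStateFull] L.mapsTo_shiftFullLaw.restrict
  continuous_leftShiftLaw : Continuous[topInFull, topInFull] L.mapsTo_leftShiftLaw.restrict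
  continuous_phiLaw : Continuous[topStateFull, topStateFull] L.mapsTo_phiLaw.restrict
  continuous_readoutLaw : Continuous[topStatePast, topOutPast] L.mapsTo_readoutLaw.restrict

/-- The projection from state laws to input laws has compact fibers. -/
def Topologies.HasCompactFibers {L : LawSets S} (𝒯 : L.Topologies) : Prop :=
  ∀ Ξ : L.inPast, @IsCompact _ 𝒯.topStatePast (L.mapsTo_inMarginal.restrict ⁻¹' {Ξ})

end LawSets

/-! ### Stochastic solutions, causality, echo state properties -/

namespace StateSpaceSystem

variable {U X Y : Type*} [TopologicalSpace U] [TopologicalSpace X] [TopologicalSpace Y]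
  (S : StateSpaceSystem U X Y)

/-- The sigma-algebra `Σ_{X,t}`, `t = -n`, generated by `Tⁿ ∘ π_X`. -/
@[reducible]
def sigmaX (n : ℕ) : MeasurableSpace (S.XPast × S.UPast) :=
  MeasurableSpace.comap (fun p => S.xPast.shift^[n] p.1) inferInstance

/-- The sigma-algebra `Σ_{U,t}`, `t = -n`, generated by `Tⁿ ∘ π_U`. -/
@[reducible]
def sigmaU (n : ℕ) : MeasurableSpace (S.XPast × S.UPast) :=
  MeasurableSpace.comap (fun p => S.uPast.shift^[n] p.2) inferInstance

theorem sigmaU_le (n : ℕ) :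
    S.sigmaU n ≤ (inferInstance : MeasurableSpace (S.XPast × S.UPast)) :=
  Measurable.comap_le
    (((S.continuous_shift_uPast.iterate n).comp continuous_snd).measurable)

/-- `μ` is causal: for every time `t = -n ≤ 0`, `Σ_{X,t}` and `Σ_{U,0}` are conditionally
independent given `Σ_{U,t}`. -/
def IsCausal (μ : RadonProb (S.XPast × S.UPast)) : Prop :=
  ∀ n : ℕ, CondIndep (S.sigmaU n) (S.sigmaX n) (S.sigmaU 0) (S.sigmaU_le n)
    (μ.1 : Measure (S.XPast × S.UPast))

end StateSpaceSystem

namespace LawSets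

variable {U X Y : Type*} [TopologicalSpace U] [TopologicalSpace X] [TopologicalSpace Y]
  {S : StateSpaceSystem U X Y} (L : LawSets S)

/-- The stochastic solutions: admissible state laws under which, for all `t = -n ≤ 0`, the state
equation `x_t = f(x_{t-1}, u_t)` holds almost surely. -/
def solutions : Set (RadonProb (S.XPast × S.UPast)) :=
  {μ | μ ∈ L.statePast ∧ ∀ n : ℕ, ∀ᵐ p ∂(μ.1 : Measure (S.XPast × S.UPast)),
    S.xPast.val p.1 n = S.f (S.xPast.val p.1 (n + 1), S.uPast.val p.2 n)}

/-- The causal stochastic solutions. -/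
def causalSolutions : Set (RadonProb (S.XPast × S.UPast)) := L.solutions ∩ {μ | S.IsCausal μ}

/-- The stochastic outputs. -/
def outputs : Set (RadonProb (S.YPast × S.UPast)) := S.readoutLaw '' L.solutions

/-- The causal stochastic outputs. -/
def causalOutputs : Set (RadonProb (S.YPast × S.UPast)) := S.readoutLaw '' L.causalSolutions

/-- The stochastic ESP. -/
def StochESP : Prop := ∀ Ξ ∈ L.inPast, ∃! μ, μ ∈ L.solutions ∧ S.inMarginal μ = Ξ

/-- The stochastic ESP in the outputs. -/
def StochESPOutputs : Prop := ∀ Ξ ∈ L.inPast, ∃! ν, ν ∈ L.outputs ∧ S.outInMarginal ν = Ξ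

/-- The causal stochastic ESP. -/
def CausalStochESP : Prop := ∀ Ξ ∈ L.inPast, ∃! μ, μ ∈ L.causalSolutions ∧ S.inMarginal μ = Ξ

/-- The causal stochastic ESP in the outputs. -/
def CausalStochESPOutputs : Prop :=
  ∀ Ξ ∈ L.inPast, ∃! ν, ν ∈ L.causalOutputs ∧ S.outInMarginal ν = Ξ

end LawSets

end

end StochReservoir

/-! Fix an input law `Ξ`. For each `n`, choose an admissible state law whose input marginal is the
`n`-fold shift of `Ξ`, and disintegrate it over the inputs to get a kernel `κ`. Draw the inputs from
`Ξ`, draw the states up to time `-n` from `κ` at the inputs up to time `-n`, and run the state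
equation for the last `n` steps. This law has marginal `Ξ`, and shifting it `n` times returns the
chosen state law, so backward shift invariance makes it admissible
(`exists_mem_statePast_eq_extendLaw`). It satisfies the state equation at times `-k` with `k < n`,
and it is causal at times `-m` with `m ≤ n`, because states up to `-m` use inputs after `-m`
nowhere.

Compactness of the fiber over `Ξ` gives a limit point of these laws. The state equations are closed
conditions and survive a weak limit. Conditional independence is not weakly closed in general, but
here all laws share the input marginal `Ξ`. Causality then says that `g(X_{≤ -m})` is orthogonal to
`1_B(U) - E[1_B(U) | U_{≤ -m}]` for bounded continuous `g`, and this second factor is one fixed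
integrable function of the inputs. Approximating it in `L¹(Ξ)` by bounded continuous functions gives
an error uniform over all these laws, so orthogonality passes to the limit
(`integral_mul_eq_zero_of_tendsto`). -/

namespace StochReservoir
noncomputable section

open scoped BoundedContinuousFunction ENNReal

/-! ### Conditional independence through bounded continuous test functions -/

/-- Two nonnegative integrable densities with the same integrals against bounded continuous
functions of `φ` have the same integrals over preimages under `φ`. -/
theorem setIntegral_preimage_eq_of_forall_boundedContinuous {Ω A : Type*} [MeasurableSpace Ω]
    [TopologicalSpace A] [MeasurableSpace A] [BorelSpace A] [HasOuterApproxClosed A]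
    {μ : Measure Ω} {φ : Ω → A} (hφ : Measurable φ) {v w : Ω → ℝ} (hv : Integrable v μ)
    (hw : Integrable w μ) (hv0 : 0 ≤ᵐ[μ] v) (hw0 : 0 ≤ᵐ[μ] w)
    (h : ∀ g : A →ᵇ ℝ, ∫ ω, g (φ ω) * v ω ∂μ = ∫ ω, g (φ ω) * w ω ∂μ) {s : Set A}
    (hs : MeasurableSet s) : ∫ ω in φ ⁻¹' s, v ω ∂μ = ∫ ω in φ ⁻¹' s, w ω ∂μ := by
  -- Integrals against `g ∘ φ` are integrals of `g` against the pushed-forward weighted measure, and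
  -- finite Borel measures on `A` are determined by such integrals.
  have integral_density : ∀ {r : Ω → ℝ}, Integrable r μ → 0 ≤ᵐ[μ] r → ∀ g : A →ᵇ ℝ,
      ∫ a, g a ∂(μ.withDensity fun ω => ENNReal.ofReal (r ω)).map φ
        = ∫ ω, g (φ ω) * r ω ∂μ := by
    intro r hr hr0 g
    rw [integral_map hφ.aemeasurable g.continuous.aestronglyMeasurable,
      integral_withDensity_eq_integral_toReal_smul₀ hr.aemeasurable.ennreal_ofReal
        (ae_of_all _ fun _ => ENNReal.ofReal_lt_top)]
    refine integral_congr_ae ?_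
    filter_upwards [hr0] with ω hω
    rw [ENNReal.toReal_ofReal hω, smul_eq_mul, mul_comm]
  have hfin : ∀ {r : Ω → ℝ}, Integrable r μ →
      IsFiniteMeasure (μ.withDensity fun ω => ENNReal.ofReal (r ω)) := fun hr =>
    isFiniteMeasure_withDensity_ofReal hr.2
  have := hfin hv
  have := hfin hw
  have heq : (μ.withDensity fun ω => ENNReal.ofReal (v ω)).map φ
      = (μ.withDensity fun ω => ENNReal.ofReal (w ω)).map φ :=
    ext_of_forall_integral_eq_of_IsFiniteMeasure fun g => by
      rw [integral_density hv hv0, integral_density hw hw0, h]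
  have hval := congrArg (fun ν : Measure A => ν s) heq
  simp only [Measure.map_apply hφ hs, withDensity_apply _ (hφ hs)] at hval
  rw [integral_eq_lintegral_of_nonneg_ae (ae_restrict_of_ae hv0) hv.1.restrict,
    integral_eq_lintegral_of_nonneg_ae (ae_restrict_of_ae hw0) hw.1.restrict, hval]

/-- Conditional independence can be tested with bounded continuous functions on one side. -/
theorem condIndep_comap_of_forall_boundedContinuous {Ω A : Type*} {m' m₂ mΩ : MeasurableSpace Ω}
    [StandardBorelSpace Ω] [TopologicalSpace A] [MeasurableSpace A] [BorelSpace A]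
    [HasOuterApproxClosed A] {μ : Measure Ω} [IsFiniteMeasure μ] {φ : Ω → A} (hφ : Measurable φ)
    (hm' : m' ≤ mΩ) (hm : m' ≤ m₂) (hm₂ : m₂ ≤ mΩ)
    (h : ∀ t, MeasurableSet[m₂] t → ∀ g : A →ᵇ ℝ,
      ∫ ω, g (φ ω) * t.indicator (fun _ => (1 : ℝ)) ω ∂μ = ∫ ω, g (φ ω) * (μ⟦t | m'⟧) ω ∂μ) :
    CondIndep m' (MeasurableSpace.comap φ inferInstance) m₂ hm' μ := by
  rw [condIndep_iff _ _ _ hm' hφ.comap_le hm₂]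
  rintro _ t ⟨s, hs, rfl⟩ ht
  have hint : ∀ r : Set Ω, MeasurableSet r → Integrable (r.indicator fun _ => (1 : ℝ)) μ :=
    fun r hr => (integrable_const _).indicator hr
  have key : ∀ r, MeasurableSet[m₂] r →
      ∫ ω in φ ⁻¹' s, r.indicator (fun _ => (1 : ℝ)) ω ∂μ = ∫ ω in φ ⁻¹' s, (μ⟦r | m'⟧) ω ∂μ := by
    intro r hr
    refine setIntegral_preimage_eq_of_forall_boundedContinuous hφ (hint r (hm₂ _ hr))
      integrable_condExp (ae_of_all _ fun ω => indicator_nonneg (fun _ _ => zero_le_one) ω)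
      (condExp_nonneg (ae_of_all _ fun ω => indicator_nonneg (fun _ _ => zero_le_one) ω)) (h r hr)
      hs
  have hmul : ∀ (r : Set Ω) (F : Ω → ℝ),
      (r.indicator fun _ => (1 : ℝ)) * F = r.indicator F := by
    intro r F
    funext ω
    by_cases hω : ω ∈ r <;> simp [hω]
  have hsΩ : MeasurableSet (φ ⁻¹' s) := hφ hs
  have hprod : Integrable ((φ ⁻¹' s).indicator (μ⟦t | m'⟧)) μ := integrable_condExp.indicator hsΩ
  -- Pulling out the `m'`-measurable factor reduces the product formula to equality of integrals
  -- over each `C` in `m'`.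
  have hpull : μ[(φ ⁻¹' s).indicator (μ⟦t | m'⟧) | m']
      =ᵐ[μ] (μ⟦φ ⁻¹' s | m'⟧) * (μ⟦t | m'⟧) := by
    have := condExp_mul_of_stronglyMeasurable_right (μ := μ) (m := m')
      (f := (φ ⁻¹' s).indicator fun _ => (1 : ℝ)) (g := μ⟦t | m'⟧) stronglyMeasurable_condExp
      (by rw [hmul]; exact hprod) (hint _ hsΩ)
    rwa [hmul] at this
  refine EventuallyEq.trans ?_ hpull
  refine EventuallyEq.symm (ae_eq_condExp_of_forall_setIntegral_eq hm'
    (hint _ (hsΩ.inter (hm₂ _ ht))) (fun _ _ _ => integrable_condExp.integrableOn) ?_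
    stronglyMeasurable_condExp.aestronglyMeasurable)
  intro C hC _
  have hCΩ := hm' _ hC
  -- Since `m' ≤ m₂`, the set `C` can be absorbed into `t`, and `key` applies to `t ∩ C`.
  have hCt : (μ⟦t ∩ C | m'⟧) =ᵐ[μ] C.indicator (μ⟦t | m'⟧) := by
    rw [inter_comm, ← indicator_indicator]
    exact condExp_indicator (hint t (hm₂ _ ht)) hC
  rw [setIntegral_condExp hm' hprod hC, setIntegral_indicator hsΩ,
    setIntegral_indicator (hsΩ.inter (hm₂ _ ht)), inter_comm C, ← setIntegral_indicator hCΩ,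
    ← integral_congr_ae (ae_restrict_of_ae hCt), ← key _ (ht.inter (hm _ hC)),
    setIntegral_indicator (hm₂ _ (ht.inter (hm _ hC)))]
  congr 2
  ext ω
  simp only [mem_inter_iff]
  tauto

/-! ### Weak limits with a fixed marginal, and conditional expectations -/

/-- For laws with a fixed second marginal `ν`, weak convergence implies convergence of integrals of
products of a bounded continuous function and a `ν`-integrable function. -/
theorem integral_mul_eq_zero_of_tendsto {ι A B : Type*} [TopologicalSpace A] [MeasurableSpace A]
    [BorelSpace A] [TopologicalSpace B] [MeasurableSpace B] [BorelSpace B] [NormalSpace B]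
    [OpensMeasurableSpace (A × B)] {l : Filter ι} [l.NeBot] {P : ι → ProbabilityMeasure (A × B)}
    {Q : ProbabilityMeasure (A × B)} (hlim : Tendsto P l (𝓝 Q)) {ν : Measure B}
    [IsFiniteMeasure ν] [ν.WeaklyRegular]
    (hP : ∀ i, (P i : Measure (A × B)).map Prod.snd = ν)
    (hQ : (Q : Measure (A × B)).map Prod.snd = ν) (g : A →ᵇ ℝ) {c : B → ℝ}
    (hc : Integrable c ν) (h0 : ∀ᶠ i in l, ∫ p, g p.1 * c p.2 ∂(P i : Measure (A × B)) = 0) :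
    ∫ p, g p.1 * c p.2 ∂(Q : Measure (A × B)) = 0 := by
  have approx : ∀ ε > 0, ‖∫ p, g p.1 * c p.2 ∂(Q : Measure (A × B))‖ ≤ 2 * (‖g‖ * ε) := by
    intro ε hε
    obtain ⟨d, hd, hdi⟩ := hc.exists_boundedContinuous_integral_sub_le hε
    -- The cost of replacing `c` by `d` depends on the law only through its marginal `ν`, so it is
    -- uniform along the net and at the limit.
    have bound : ∀ R : ProbabilityMeasure (A × B), (R : Measure (A × B)).map Prod.snd = ν →
        ‖(∫ p, g p.1 * c p.2 ∂(R : Measure (A × B))) - ∫ p, g p.1 * d p.2 ∂(R : Measure (A × B))‖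
          ≤ ‖g‖ * ε := by
      intro R hR
      have hg : AEStronglyMeasurable (fun p : A × B => g p.1) (R : Measure (A × B)) :=
        (g.continuous.measurable.comp measurable_fst).aestronglyMeasurable
      have hi : ∀ {k : B → ℝ}, Integrable k ν →
          Integrable (fun p : A × B => k p.2) (R : Measure (A × B)) := by
        intro k hk
        rw [← hR] at hk
        exact hk.comp_measurable measurable_snd
      have him : ∀ {k : B → ℝ}, Integrable k ν →
          Integrable (fun p : A × B => g p.1 * k p.2) (R : Measure (A × B)) := fun hk =>
        (hi hk).bdd_mul hg (ae_of_all _ fun p => g.norm_coe_le_norm p.1)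
      rw [← integral_sub (him hc) (him hdi)]
      calc _ ≤ ∫ p, ‖g‖ * ‖c p.2 - d p.2‖ ∂(R : Measure (A × B)) := by
            refine norm_integral_le_of_norm_le ((hi (hc.sub hdi)).norm.const_mul _)
              (ae_of_all _ fun p => ?_)
            rw [← mul_sub, norm_mul]
            exact mul_le_mul_of_nonneg_right (g.norm_coe_le_norm _) (norm_nonneg _)
        _ = ‖g‖ * ∫ b, ‖c b - d b‖ ∂ν := by
            have hm : AEStronglyMeasurable (fun b => ‖c b - d b‖) ν :=
              (hc.sub hdi).norm.aestronglyMeasurable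
            rw [← hR] at hm ⊢
            rw [integral_const_mul, integral_map measurable_snd.aemeasurable hm]
        _ ≤ ‖g‖ * ε := mul_le_mul_of_nonneg_left hd (norm_nonneg _)
    let G : (A × B) →ᵇ ℝ := (g.compContinuous ⟨Prod.fst, continuous_fst⟩)
      * (d.compContinuous ⟨Prod.snd, continuous_snd⟩)
    -- Along the net the integral with `c` vanishes, so the one with `d` is at most `‖g‖ * ε`; `G`
    -- is bounded continuous, so the bound passes to `Q`. Returning from `d` to `c` under `Q` costs
    -- the second `‖g‖ * ε`.
    have hG : ‖∫ p, g p.1 * d p.2 ∂(Q : Measure (A × B))‖ ≤ ‖g‖ * ε := by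
      have ht := (ProbabilityMeasure.tendsto_iff_forall_integral_tendsto.1 hlim G).norm
      refine le_of_tendsto ht (h0.mono fun i hi => ?_)
      have := bound (P i) (hP i)
      rwa [hi, zero_sub, norm_neg] at this
    calc _ = ‖((∫ p, g p.1 * c p.2 ∂(Q : Measure (A × B)))
            - ∫ p, g p.1 * d p.2 ∂(Q : Measure (A × B)))
            + ∫ p, g p.1 * d p.2 ∂(Q : Measure (A × B))‖ := by rw [sub_add_cancel]
      _ ≤ ‖g‖ * ε + ‖g‖ * ε := (norm_add_le _ _).trans (add_le_add (bound Q hQ) hG)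
      _ = 2 * (‖g‖ * ε) := by ring
  have hlim0 : Tendsto (fun ε : ℝ => 2 * (‖g‖ * ε)) (𝓝[>] 0) (𝓝 0) := by
    have : Continuous fun ε : ℝ => 2 * (‖g‖ * ε) := by fun_prop
    simpa using (this.tendsto 0).mono_left nhdsWithin_le_nhds
  exact norm_le_zero_iff.1 (ge_of_tendsto hlim0 (eventually_mem_nhdsWithin.mono approx))

/-- The conditional expectation error is orthogonal to bounded measurable functions. -/
theorem integral_mul_sub_condExp_eq_zero {Ω : Type*} {m mΩ : MeasurableSpace Ω} (hm : m ≤ mΩ)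
    {ν : Measure Ω} [IsFiniteMeasure ν] {G b : Ω → ℝ} (hG : StronglyMeasurable[m] G) {K : ℝ}
    (hK : ∀ ω, ‖G ω‖ ≤ K) (hb : Integrable b ν) :
    ∫ ω, G ω * (b ω - (ν[b | m]) ω) ∂ν = 0 := by
  have hi : ∀ {k : Ω → ℝ}, Integrable k ν → Integrable (fun ω => G ω * k ω) ν := fun hk =>
    hk.bdd_mul (hG.mono hm).aestronglyMeasurable (ae_of_all _ hK)
  have hpull := condExp_stronglyMeasurable_mul_of_bound hm hG hb K (ae_of_all ν hK)
  have := integral_condExp (μ := ν) hm (f := G * b)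
  rw [integral_congr_ae hpull] at this
  simp only [mul_sub]
  rw [integral_sub (hi hb) (hi integrable_condExp), sub_eq_zero]
  exact this.symm

/-- Conditional expectations commute with measure-preserving maps. -/
theorem condExp_comap_comp {Ω Ω' : Type*} {m : MeasurableSpace Ω'} {mΩ : MeasurableSpace Ω}
    {mΩ' : MeasurableSpace Ω'} (hm : m ≤ mΩ') {μ : Measure Ω} [IsFiniteMeasure μ]
    {ν : Measure Ω'} [IsFiniteMeasure ν] {q : Ω → Ω'} (hq : MeasurePreserving q μ ν)
    {b : Ω' → ℝ} (hb : Integrable b ν) :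
    (ν[b | m]) ∘ q =ᵐ[μ] μ[b ∘ q | MeasurableSpace.comap q m] := by
  have hle : MeasurableSpace.comap q m ≤ mΩ :=
    (MeasurableSpace.comap_mono hm).trans hq.measurable.comap_le
  refine ae_eq_condExp_of_forall_setIntegral_eq hle (hq.integrable_comp_of_integrable hb)
    (fun _ _ _ => (hq.integrable_comp_of_integrable integrable_condExp).integrableOn) ?_
    (stronglyMeasurable_condExp.comp_measurable
      (comap_measurable q)).aestronglyMeasurable
  rintro _ ⟨C, hC, rfl⟩ _
  have hset : ∀ {k : Ω' → ℝ}, Integrable k ν →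
      ∫ ω in q ⁻¹' C, (k ∘ q) ω ∂μ = ∫ y in C, k y ∂ν := by
    intro k hk
    have hk' := hk.aestronglyMeasurable
    rw [← hq.map_eq] at hk' ⊢
    exact (setIntegral_map (hm _ hC) hk' hq.measurable.aemeasurable).symm
  rw [hset integrable_condExp, hset hb, setIntegral_condExp hm hb hC]

/-! ### States driven by the state equation -/

theorem PastSpace.val_iterate_shift {A : Type*} [TopologicalSpace A] (Z : PastSpace A) (m k : ℕ) (a : Z.Seq) :
    Z.val (Z.shift^[m] a) k = Z.val a (k + m) := by
  induction m generalizing a with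
  | zero => rfl
  | succ m ih =>
    rw [Function.iterate_succ_apply, ih]
    rfl

namespace StateSpaceSystem

variable {U X Y : Type*} [TopologicalSpace U] [TopologicalSpace X] [TopologicalSpace Y]
  (S : StateSpaceSystem U X Y)

/-- `S.extend n (x, u)` appends to the past states `x`, placed at times `≤ -n`, the `n` states
driven by the inputs `u_{-n+1}, …, u_0`. -/
def extend : ℕ → S.XPast × S.UPast → S.XPast
  | 0, p => p.1
  | n + 1, p => S.xPast.concat (extend n (p.1, S.uPast.shift p.2),
      S.f (S.xPast.val (extend n (p.1, S.uPast.shift p.2)) 0, S.uPast.val p.2 0))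

theorem continuous_extend (n : ℕ) : Continuous (S.extend n) := by
  induction n with
  | zero => exact continuous_fst
  | succ n ih =>
    have h1 : Continuous fun p : S.XPast × S.UPast => S.extend n (p.1, S.uPast.shift p.2) :=
      ih.comp (continuous_fst.prodMk (S.continuous_shift_uPast.comp continuous_snd))
    have h2 := (continuous_apply 0).comp (S.xPast.continuous_val.comp h1)
    have h3 : Continuous fun p : S.XPast × S.UPast => S.uPast.val p.2 0 :=
      (continuous_apply 0).comp (S.uPast.continuous_val.comp continuous_snd)
    exact S.continuous_concat_xPast.comp
      (h1.prodMk (S.continuous_f.comp (h2.prodMk h3)))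

theorem shift_extend_succ (n : ℕ) (p : S.XPast × S.UPast) :
    S.xPast.shift (S.extend (n + 1) p) = S.extend n (p.1, S.uPast.shift p.2) := rfl

/-- Deleting the last `m` driven states also deletes the inputs that produced them. This adaptedness
is the source of causality. -/
theorem iterate_shift_extend (m n : ℕ) (p : S.XPast × S.UPast) :
    S.xPast.shift^[m] (S.extend (m + n) p) = S.extend n (p.1, S.uPast.shift^[m] p.2) := by
  induction m generalizing p with
  | zero => simp
  | succ m ih =>
    rw [Function.iterate_succ_apply, Nat.add_right_comm, shift_extend_succ, ih,
      Function.iterate_succ_apply]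

theorem val_extend_of_lt {k n : ℕ} (hk : k < n) (p : S.XPast × S.UPast) :
    S.xPast.val (S.extend n p) k
      = S.f (S.xPast.val (S.extend n p) (k + 1), S.uPast.val p.2 k) := by
  -- After `k` shifts, entries `k` and `k + 1` become entries `0` and `1` of an extension by `j + 1`
  -- steps, where the state equation holds by definition.
  obtain ⟨j, rfl⟩ := Nat.exists_eq_add_of_lt hk
  have e := S.iterate_shift_extend k (j + 1) p
  rw [← Nat.zero_add k, ← PastSpace.val_iterate_shift, Nat.zero_add k, add_comm k 1, ← PastSpace.val_iterate_shift,
    add_assoc, e, ← Nat.zero_add k, ← PastSpace.val_iterate_shift, Nat.zero_add]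
  rfl

/-- The state equation at time `-k` is a closed condition. -/
theorem isClosed_stateEq [T2Space X] (k : ℕ) : IsClosed {p : S.XPast × S.UPast |
    S.xPast.val p.1 k = S.f (S.xPast.val p.1 (k + 1), S.uPast.val p.2 k)} := by
  have hx : ∀ i, Continuous fun p : S.XPast × S.UPast => S.xPast.val p.1 i := fun i =>
    (continuous_apply i).comp (S.xPast.continuous_val.comp continuous_fst)
  have hu : Continuous fun p : S.XPast × S.UPast => S.uPast.val p.2 k :=
    (continuous_apply k).comp (S.uPast.continuous_val.comp continuous_snd)
  exact isClosed_eq (hx k) (S.continuous_f.comp ((hx (k + 1)).prodMk hu))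

/-! ### The approximating laws -/

/-- The law of `(X, U)` when `U` has law `Ξ`, the states up to time `-n` have the conditional law
`κ` given the inputs up to time `-n`, and the later states are driven by the state equation. -/
def extendLaw (n : ℕ) (Ξ : Measure S.UPast) (κ : Kernel S.UPast S.XPast) :
    Measure (S.XPast × S.UPast) :=
  (Ξ ⊗ₘ κ.comap S.uPast.shift^[n] (S.continuous_shift_uPast.iterate n).measurable).map
    fun q => (S.extend n (q.2, q.1), q.1)

theorem measurable_extend_swap (n : ℕ) :
    Measurable fun q : S.UPast × S.XPast => (S.extend n (q.2, q.1), q.1) :=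
  (((S.continuous_extend n).comp continuous_swap).prodMk continuous_fst).measurable

instance (n : ℕ) (Ξ : Measure S.UPast) [IsProbabilityMeasure Ξ] (κ : Kernel S.UPast S.XPast)
    [IsMarkovKernel κ] : IsProbabilityMeasure (S.extendLaw n Ξ κ) :=
  Measure.isProbabilityMeasure_map (S.measurable_extend_swap n).aemeasurable

theorem ae_extendLaw_state_eq [T2Space X] (n : ℕ) (Ξ : Measure S.UPast)
    (κ : Kernel S.UPast S.XPast) {k : ℕ} (hk : k < n) :
    ∀ᵐ p ∂S.extendLaw n Ξ κ,
      S.xPast.val p.1 k = S.f (S.xPast.val p.1 (k + 1), S.uPast.val p.2 k) := by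
  refine (mem_ae_map_iff (S.measurable_extend_swap n).aemeasurable
    (S.isClosed_stateEq k).measurableSet).2 (ae_of_all _ fun q => ?_)
  exact S.val_extend_of_lt hk (q.2, q.1)

variable (n : ℕ) (Ξ : Measure S.UPast) [IsProbabilityMeasure Ξ] (κ : Kernel S.UPast S.XPast)
  [IsMarkovKernel κ]

theorem map_snd_extendLaw : (S.extendLaw n Ξ κ).map Prod.snd = Ξ := by
  rw [extendLaw, Measure.map_map measurable_snd (S.measurable_extend_swap n)]
  exact Measure.fst_compProd Ξ _

/-- Shifting `n` times undoes the extension and leaves the initial states with the inputs up to time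
`-n`. With `κ` a disintegration of an admissible law, this recovers that law; the swap is there
because `⊗ₘ` lists the input first. -/
theorem map_shift_extendLaw : (S.extendLaw n Ξ κ).map (S.shiftPast^[n])
    = ((Ξ.map S.uPast.shift^[n]) ⊗ₘ κ).map Prod.swap := by
  have hT := (S.continuous_shift_uPast.iterate n).measurable
  have hf : ∀ q : S.UPast × S.XPast, S.shiftPast^[n] (S.extend n (q.2, q.1), q.1)
      = (q.2, S.uPast.shift^[n] q.1) := by
    intro q
    have : S.shiftPast = Prod.map S.xPast.shift S.uPast.shift := rfl
    rw [this, Prod.map_iterate]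
    exact Prod.ext (S.iterate_shift_extend n 0 (q.2, q.1)) rfl
  rw [extendLaw, Measure.map_map (S.continuous_shiftPast.iterate n).measurable
    (S.measurable_extend_swap n)]
  have hc : (S.shiftPast^[n] ∘ fun q : S.UPast × S.XPast => (S.extend n (q.2, q.1), q.1))
      = Prod.swap ∘ Prod.map S.uPast.shift^[n] id := funext hf
  rw [hc, ← Measure.map_map measurable_swap (hT.prodMap measurable_id)]
  congr 1
  ext s hs
  rw [Measure.map_apply (hT.prodMap measurable_id) hs,
    Measure.compProd_apply ((hT.prodMap measurable_id) hs), Measure.compProd_apply hs,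
    lintegral_map (Kernel.measurable_kernel_prodMk_left hs) hT]
  rfl

/-- Causality at time `-m` before passing to the limit. The states up to `-m` are built from the
initial states and the inputs up to `-m`; averaging over the initial states leaves a bounded
function of those inputs, which is orthogonal to the prediction error of `b`. -/
theorem integral_extendLaw_mul_sub_condExp {m : ℕ} (hm : m ≤ n) (g : S.XPast →ᵇ ℝ)
    {b : S.UPast → ℝ} (hb : Integrable b Ξ) :
    ∫ p, g (S.xPast.shift^[m] p.1)
      * (b p.2 - (Ξ[b | MeasurableSpace.comap S.uPast.shift^[m] inferInstance]) p.2)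
      ∂S.extendLaw n Ξ κ = 0 := by
  obtain ⟨j, rfl⟩ := Nat.exists_eq_add_of_le hm
  set T : ℕ → S.UPast → S.UPast := fun m => S.uPast.shift^[m]
  have hT : ∀ m, Measurable (T m) := fun m => (S.continuous_shift_uPast.iterate m).measurable
  set c : S.UPast → ℝ := fun u => b u - (Ξ[b | MeasurableSpace.comap (T m) inferInstance]) u
  have hc : Integrable c Ξ := hb.sub integrable_condExp
  have hg : StronglyMeasurable fun q : S.UPast × S.XPast => g (S.extend j (q.2, q.1)) :=
    ((g.continuous.comp ((S.continuous_extend j).comp continuous_swap)).measurable).stronglyMeasurable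
  -- The conditional mean of `g` given that the inputs up to time `-m` are `w`; here `n = m + j`, so
  -- the kernel is evaluated `j` shifts further back.
  set G : S.UPast → ℝ := fun w => ∫ x, g (S.extend j (x, w)) ∂κ (T j w)
  have hG : StronglyMeasurable G :=
    hg.integral_kernel_prod_right' (κ := κ.comap (T j) (hT j))
  have hGb : ∀ w, ‖G w‖ ≤ ‖g‖ := fun w => by
    have := norm_integral_le_of_norm_le_const (μ := κ (T j w))
      (ae_of_all _ fun x => g.norm_coe_le_norm (S.extend j (x, w)))
    simpa using this
  have hcomp : ∀ q : S.UPast × S.XPast, g (S.xPast.shift^[m] (S.extend (m + j) (q.2, q.1)))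
      = g (S.extend j (q.2, T m q.1)) := fun q => by rw [iterate_shift_extend]
  have hgm : StronglyMeasurable fun q : S.UPast × S.XPast => g (S.extend j (q.2, T m q.1)) :=
    hg.comp_measurable (((hT m).comp measurable_fst).prodMk measurable_snd)
  set η := κ.comap (T (m + j)) (hT (m + j))
  have hci : Integrable (fun q : S.UPast × S.XPast => c q.1) (Ξ ⊗ₘ η) := by
    have := hc
    rw [← Measure.fst_compProd Ξ η] at this
    exact this.comp_measurable measurable_fst
  have hint : Integrable (fun q : S.UPast × S.XPast => g (S.extend j (q.2, T m q.1)) * c q.1)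
      (Ξ ⊗ₘ η) :=
    hci.bdd_mul hgm.aestronglyMeasurable (ae_of_all _ fun q => g.norm_coe_le_norm _)
  have hcs : AEStronglyMeasurable (fun p : S.XPast × S.UPast =>
      g (S.xPast.shift^[m] p.1) * c p.2) (S.extendLaw (m + j) Ξ κ) := by
    refine AEStronglyMeasurable.mul (Continuous.aestronglyMeasurable ?_) ?_
    · exact g.continuous.comp ((S.continuous_shift_xPast.iterate m).comp continuous_fst)
    · have := hc.aestronglyMeasurable
      rw [← S.map_snd_extendLaw (m + j) Ξ κ] at this
      exact this.comp_measurable measurable_snd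
  change ∫ p, g (S.xPast.shift^[m] p.1) * c p.2 ∂S.extendLaw (m + j) Ξ κ = 0
  rw [extendLaw] at hcs ⊢
  rw [integral_map (S.measurable_extend_swap _).aemeasurable hcs]
  simp only [hcomp]
  rw [Measure.integral_compProd hint]
  simp only [integral_mul_const]
  -- The initial states depend on `T (m + j) u = T j (T m u)`, hence only on the inputs up to time
  -- `-m`.
  have hη : ∀ u, ∫ x, g (S.extend j (x, T m u)) ∂η u = G (T m u) := by
    intro u
    have : T (m + j) u = T j (T m u) := by
      simp only [T]
      rw [add_comm, Function.iterate_add_apply]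
    simp only [η, Kernel.comap_apply, G, this]
  simp only [hη]
  exact integral_mul_sub_condExp_eq_zero (hT m).comap_le
    (hG.comp_measurable (comap_measurable (T m))) (fun u => hGb (T m u)) hb

end StateSpaceSystem

/-! ### Passing the state equation and causality to weak limits -/

theorem RadonProb.coe_map_iterate {Z : Type*} [TopologicalSpace Z] [MeasurableSpace Z] [BorelSpace Z]
    {g : Z → Z} (hg : Continuous g) (n : ℕ) (μ : RadonProb Z) :
    (((RadonProb.map g hg)^[n] μ).1 : Measure Z) = (μ.1 : Measure Z).map g^[n] := by
  induction n generalizing μ with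
  | zero => exact Measure.map_id.symm
  | succ n ih =>
    rw [Function.iterate_succ_apply, ih, Function.iterate_succ,
      ← Measure.map_map (hg.iterate n).measurable hg.measurable]
    rfl

theorem iterate_mem_iff_of_preimage_eq {α : Type*} {F : α → α} {s : Set α} (h : F ⁻¹' s = s)
    (n : ℕ) (a : α) : F^[n] a ∈ s ↔ a ∈ s := by
  induction n generalizing a with
  | zero => rfl
  | succ n ih =>
    rw [Function.iterate_succ_apply, ih]
    exact Set.ext_iff.1 h a

/-- A closed event that eventually has full probability has full probability in the weak limit. -/
theorem ae_mem_of_tendsto_of_isClosed {ι Ω : Type*} [MeasurableSpace Ω] [TopologicalSpace Ω]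
    [OpensMeasurableSpace Ω] [HasOuterApproxClosed Ω] {l : Filter ι} [l.NeBot]
    {P : ι → ProbabilityMeasure Ω} {Q : ProbabilityMeasure Ω} (hlim : Tendsto P l (𝓝 Q))
    {F : Set Ω} (hF : IsClosed F) (h : ∀ᶠ i in l, ∀ᵐ ω ∂(P i : Measure Ω), ω ∈ F) :
    ∀ᵐ ω ∂(Q : Measure Ω), ω ∈ F := by
  have hle := ProbabilityMeasure.limsup_measure_closed_le_of_tendsto hlim hF
  have h1 : (fun i => (P i : Measure Ω) F) =ᶠ[l] fun _ => 1 :=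
    h.mono fun i hi => prob_compl_eq_zero_iff hF.measurableSet |>.1 hi
  rw [limsup_congr h1, limsup_const] at hle
  exact prob_compl_eq_zero_iff hF.measurableSet |>.2 (le_antisymm prob_le_one hle)

namespace StateSpaceSystem

variable {U X Y : Type*} [TopologicalSpace U] [TopologicalSpace X] [TopologicalSpace Y]
  (S : StateSpaceSystem U X Y)

/-- A law is causal as soon as, for bounded continuous functions `g` of the past states, `g` is
uncorrelated with the errors of predicting input events from past inputs. -/
theorem isCausal_of_forall_integral_eq_zero (μ : RadonProb (S.XPast × S.UPast))
    (h : ∀ (m : ℕ) (g : S.XPast →ᵇ ℝ) (B : Set S.UPast), MeasurableSet B →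
      ∫ p, g (S.xPast.shift^[m] p.1) * (B.indicator (fun _ => (1 : ℝ)) p.2
        - (((S.inMarginal μ).1 : Measure S.UPast)[B.indicator fun _ => (1 : ℝ) |
          MeasurableSpace.comap S.uPast.shift^[m] inferInstance]) p.2)
        ∂(μ.1 : Measure (S.XPast × S.UPast)) = 0) :
    S.IsCausal μ := by
  intro m
  have hT := (S.continuous_shift_uPast.iterate m).measurable
  have hφ : Measurable fun p : S.XPast × S.UPast => S.xPast.shift^[m] p.1 :=
    ((S.continuous_shift_xPast.iterate m).comp continuous_fst).measurable
  -- Conditioning on past inputs can be done on the input space under the input marginal, so the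
  -- prediction error does not depend on the joint law.
  have hle : S.sigmaU m = MeasurableSpace.comap Prod.snd
      (MeasurableSpace.comap S.uPast.shift^[m] inferInstance) := MeasurableSpace.comap_comp.symm
  refine condIndep_comap_of_forall_boundedContinuous hφ (S.sigmaU_le m) ?_ (S.sigmaU_le 0) ?_
  · rw [hle]
    exact MeasurableSpace.comap_mono hT.comap_le
  rintro _ ⟨B, hB, rfl⟩ g
  have hq : MeasurePreserving Prod.snd (μ.1 : Measure (S.XPast × S.UPast))
      ((S.inMarginal μ).1 : Measure S.UPast) := ⟨measurable_snd, rfl⟩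
  have hb : Integrable (B.indicator fun _ => (1 : ℝ)) ((S.inMarginal μ).1 : Measure S.UPast) :=
    (integrable_const _).indicator hB
  have hce := condExp_comap_comp hT.comap_le hq hb
  rw [← hle] at hce
  have hi : ∀ {k : S.XPast × S.UPast → ℝ}, Integrable k (μ.1 : Measure (S.XPast × S.UPast)) →
      Integrable (fun p => g (S.xPast.shift^[m] p.1) * k p)
        (μ.1 : Measure (S.XPast × S.UPast)) := fun hk =>
    hk.bdd_mul (g.continuous.measurable.comp hφ).aestronglyMeasurable
      (ae_of_all _ fun p => g.norm_coe_le_norm _)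
  have h0 := h m g B hB
  simp only [mul_sub] at h0
  have h1 := (integral_sub (hi (hq.integrable_comp_of_integrable hb))
    (hi (hq.integrable_comp_of_integrable integrable_condExp))).symm.trans h0
  refine (sub_eq_zero.1 h1).trans (integral_congr_ae ?_)
  filter_upwards [hce] with p hp
  exact congrArg (g (S.xPast.shift^[m] p.1) * ·) hp

end StateSpaceSystem

/-! ### Existence of causal solutions -/

namespace LawSets

variable {U X Y : Type*} [TopologicalSpace U] [TopologicalSpace X] [TopologicalSpace Y]
  {S : StateSpaceSystem U X Y} (L : LawSets S)

/-- Every admissible input law is the input marginal of an admissible state law obtained by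
extending, for `n` time steps, a causal coupling up to time `-n`. -/
theorem exists_mem_statePast_eq_extendLaw {Ξ : RadonProb S.UPast} (hΞ : Ξ ∈ L.inPast) (n : ℕ) :
    ∃ μ ∈ L.statePast, S.inMarginal μ = Ξ ∧ ∃ κ : Kernel S.UPast S.XPast, IsMarkovKernel κ ∧
      (μ.1 : Measure (S.XPast × S.UPast)) = S.extendLaw n Ξ.1 κ := by
  have hΞn : S.shiftInLaw^[n] Ξ ∈ L.inPast :=
    (iterate_mem_iff_of_preimage_eq L.shift_preimage_inPast n Ξ).2 hΞ
  rw [← L.inMarginal_image] at hΞn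
  obtain ⟨ν, hν, hνΞ⟩ := hΞn
  -- Needed to form the conditional kernel of `ρ`, which is `ν` with the input coordinate first.
  have : Nonempty S.XPast := ν.1.nonempty.map Prod.fst
  set ρ : Measure (S.UPast × S.XPast) := (ν.1 : Measure (S.XPast × S.UPast)).map Prod.swap
  have : IsProbabilityMeasure ρ := Measure.isProbabilityMeasure_map measurable_swap.aemeasurable
  have hρ : ρ.fst = (Ξ.1 : Measure S.UPast).map S.uPast.shift^[n] := by
    rw [← RadonProb.coe_map_iterate S.continuous_shift_uPast]
    change _ = ((S.shiftInLaw^[n] Ξ).1 : Measure S.UPast)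
    rw [← hνΞ]
    exact Measure.map_map measurable_fst measurable_swap
  refine ⟨⟨⟨S.extendLaw n Ξ.1 ρ.condKernel, inferInstance⟩, ?_⟩, ?_, ?_, ρ.condKernel,
    inferInstance, rfl⟩
  · change (S.extendLaw n Ξ.1 ρ.condKernel).InnerRegular
    infer_instance
  -- By backward shift invariance it suffices that the `n`-fold shift is admissible, and that shift
  -- is `ν`.
  · rw [← iterate_mem_iff_of_preimage_eq L.shift_preimage_statePast n]
    convert hν
    apply Subtype.ext
    apply Subtype.ext
    refine (RadonProb.coe_map_iterate S.continuous_shiftPast n _).trans ?_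
    refine (S.map_shift_extendLaw n Ξ.1 ρ.condKernel).trans ?_
    rw [← hρ, ρ.disintegrate ρ.condKernel, Measure.map_map measurable_swap measurable_swap,
      Prod.swap_swap_eq, Measure.map_id]
    rfl
  · apply Subtype.ext
    apply Subtype.ext
    exact S.map_snd_extendLaw n Ξ.1 ρ.condKernel

/-- If the projection from state laws to input laws has compact fibers, every admissible input law
has a causal stochastic solution. -/
theorem exists_causalSolution [T2Space X] (𝒯 : L.Topologies) (hcompact : 𝒯.HasCompactFibers)
    {Ξ : RadonProb S.UPast} (hΞ : Ξ ∈ L.inPast) :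
    ∃ μ ∈ L.causalSolutions, S.inMarginal μ = Ξ := by
  choose P hP hPΞ κ hκ hPκ using L.exists_mem_statePast_eq_extendLaw hΞ
  -- The topology on state laws may be any admissible refinement of the weak one, so compactness is
  -- used through an ultrafilter rather than a subsequence.
  let 𝒰 : Ultrafilter ℕ := Ultrafilter.of atTop
  have h𝒰 : (𝒰 : Filter ℕ) ≤ atTop := Ultrafilter.of_le _
  obtain ⟨⟨μ, hμ⟩, hμΞ, hlim⟩ := @IsCompact.ultrafilter_le_nhds _ 𝒯.topStatePast _
    (hcompact ⟨Ξ, hΞ⟩) (𝒰.map fun n => ⟨P n, hP n⟩)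
    (le_principal_iff.2 (Ultrafilter.mem_map.2 (Filter.univ_mem' fun n => Subtype.ext (hPΞ n))))
  have hμΞ' : S.inMarginal μ = Ξ := congrArg Subtype.val hμΞ
  have hweak : Tendsto (fun n => (P n).1) 𝒰 (𝓝 μ.1) := by
    have hle : Tendsto (fun n => (⟨P n, hP n⟩ : L.statePast)) 𝒰 (𝓝 ⟨μ, hμ⟩) :=
      le_trans hlim (nhds_mono 𝒯.statePast_le_weak)
    exact (continuous_subtype_val.tendsto _).comp ((continuous_subtype_val.tendsto _).comp hle)
  refine ⟨μ, ⟨⟨hμ, fun k => ?_⟩, ?_⟩, hμΞ'⟩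
  · refine ae_mem_of_tendsto_of_isClosed hweak (S.isClosed_stateEq k) (h𝒰 ?_)
    filter_upwards [eventually_gt_atTop k] with n hn
    have := hκ n
    rw [hPκ n]
    exact S.ae_extendLaw_state_eq n Ξ.1 (κ n) hn
  · refine S.isCausal_of_forall_integral_eq_zero μ fun m g B hB => ?_
    rw [hμΞ']
    have hb : Integrable (B.indicator fun _ => (1 : ℝ)) (Ξ.1 : Measure S.UPast) :=
      (integrable_const _).indicator hB
    refine integral_mul_eq_zero_of_tendsto hweak (ν := (Ξ.1 : Measure S.UPast))
      (fun n => congrArg (fun ξ : RadonProb S.UPast => (ξ.1 : Measure S.UPast)) (hPΞ n))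
      (congrArg (fun ξ : RadonProb S.UPast => (ξ.1 : Measure S.UPast)) hμΞ')
      (g.compContinuous ⟨_, S.continuous_shift_xPast.iterate m⟩)
      (hb.sub integrable_condExp) (h𝒰 ?_)
    -- Causality at time `-m` is available only once the extension has length at least `m`.
    filter_upwards [eventually_ge_atTop m] with n hn
    have := hκ n
    rw [hPκ n]
    exact S.integral_extendLaw_mul_sub_condExp n Ξ.1 (κ n) hn g hb

end LawSets
end
end StochReservoir

theorem mainTheorem8 {U X Y : Type*} [TopologicalSpace U] [T2Space U] [TopologicalSpace X]
    [T2Space X] [TopologicalSpace Y] [T2Space Y]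
    (S : StochReservoir.StateSpaceSystem U X Y) (L : StochReservoir.LawSets S)
    (𝒯 : L.Topologies) (hcompact : 𝒯.HasCompactFibers) :
    (∀ Ξ ∈ L.inPast, ∃ μ ∈ L.causalSolutions, S.inMarginal μ = Ξ) ∧
      (L.StochESP → L.CausalStochESP) ∧
      (L.StochESPOutputs → L.CausalStochESPOutputs) := by
  have hex : ∀ Ξ ∈ L.inPast, ∃ μ ∈ L.causalSolutions, S.inMarginal μ = Ξ := fun Ξ hΞ =>
    L.exists_causalSolution 𝒯 hcompact hΞ
  refine ⟨hex, fun h Ξ hΞ => ?_, fun h Ξ hΞ => ?_⟩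
  -- Existence is the first claim; uniqueness is inherited because causal solutions are solutions,
  -- and likewise for outputs.
  · obtain ⟨μ, hμ, hμΞ⟩ := hex Ξ hΞ
    exact ⟨μ, ⟨hμ, hμΞ⟩, fun ν hν => (h Ξ hΞ).unique ⟨hν.1.1, hν.2⟩ ⟨hμ.1, hμΞ⟩⟩
  · obtain ⟨μ, hμ, hμΞ⟩ := hex Ξ hΞ
    have hout : S.outInMarginal (S.readoutLaw μ) = Ξ :=
      (StochReservoir.RadonProb.map_map S.continuous_extendedReadout continuous_snd μ).trans hμΞ
    refine ⟨S.readoutLaw μ, ⟨mem_image_of_mem _ hμ, hout⟩, fun ν hν => ?_⟩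
    exact (h Ξ hΞ).unique ⟨image_mono (fun _ hx => hx.1) hν.1, hν.2⟩
      ⟨mem_image_of_mem _ hμ.1, hout⟩
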